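/- Let $\mathbb T\subseteq\mathbb R$ be a time scale, i.e. a closed set, with $0\in\mathbb T$. Put $\sigma(t)=\inf\{s\in\mathbb T:s>t\}$ (with $\inf\emptyset=\sup\mathbb T$), $\rho(t)=\sup\{s\in\mathbb T:s<t\}$ (with $\sup\emptyset=\inf\mathbb T$) and $\mu(t)=\sigma(t)-t$. A point $t\in\mathbb T$ is right-dense if $\sigma(t)=t$, left-dense if $\rho(t)=t$, and left-scattered if $\rho(t)<t$; $\mathbb T^\kappa$ is $\mathbb T$ without its left-scattered maximum, if there is one. For $x:\mathbb T\to\mathbb C$ and $t\in\mathbb T^\kappa$ the delta derivative is $$x^\Delta(t)=\lim_{s\to t,\ s\in\mathbb T,\ s\neq\sigma(t)}\frac{x(\sigma(t))-x(s)}{\sigma(t)-s}$$ (where $s=t$ is allowed if $\sigma(t)>t$), and $\langle x(t)\rangle=\frac{x(t)+x(\sigma(t))}{2}$. The delta integral is $\int_a^b f(s)\,\Delta s=F(b)-F(a)$, where $F$ is a delta antiderivative of $f$, that is, $F^\Delta=f$ on $\mathbb T^\kappa$. Let $\alpha:\mathbb T\to\mathbb C$ be rd-continuous (continuous at right-dense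 points, with finite left-hand limits at left-dense points) and regressive ($\mu(t)\alpha(t)\neq\pm2$ for all $t\in\mathbb T^\kappa$). Define $$E_\alpha(t)=\exp\left(\int_0^t\zeta_{\mu(s)}(\alpha(s))\,\Delta s\right),\qquad \zeta_h(z)=\frac1h\log\frac{1+\frac12zh}{1-\frac12zh}\ (h>0),\qquad \zeta_0(z)=z,$$ with the principal branch of the logarithm, and $$\mathrm{Cosh}_\alpha(t)=\frac{E_\alpha(t)+E_{-\alpha}(t)}2,\qquad \mathrm{Sinh}_\alpha(t)=\frac{E_\alpha(t)-E_{-\alpha}(t)}2 .$$ Theorem 3.19. For all $t\in\mathbb T$, $$\mathrm{Cosh}_\alpha^2(t)-\mathrm{Sinh}_\alpha^2(t)=1,$$ and for all $t\in\mathbb T^\kappa$ the functions $\mathrm{Cosh}_\alpha$ and $\mathrm{Sinh}_\alpha$ are delta differentiable at $t$ with $$\mathrm{Cosh}_\alpha^\Delta(t)=\alpha(t)\,\langle\mathrm{Sinh}_\alpha(t)\rangle,\qquad \mathrm{Sinh}_\alpha^\Delta(t)=\alpha(t)\,\langle\mathrm{Cosh}_\alpha(t)\rangle .$$ (If $\mathbb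 T=\{0\}$, the limit defining the delta derivative is over an empty set and the last two equations are void.) -/

import Mathlib

open Filter Topology Set

noncomputable section

namespace TimeScale

/-- Forward jump operator `σ(t) = inf {s ∈ T : s > t}`, with `inf ∅ = sup T`. -/
def sigma (T : Set ℝ) (t : ℝ) : ℝ :=
  open Classical in
  if {s ∈ T | t < s}.Nonempty then sInf {s ∈ T | t < s} else sSup T

/-- Backward jump operator `ρ(t) = sup {s ∈ T : s < t}`, with `sup ∅ = inf T`. -/
def rho (T : Set ℝ) (t : ℝ) : ℝ :=
  open Classical in
  if {s ∈ T | s < t}.Nonempty then sSup {s ∈ T | s < t} else sInf T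

/-- Graininess `μ(t) = σ(t) - t`. -/
def graininess (T : Set ℝ) (t : ℝ) : ℝ := sigma T t - t

/-- `T^κ`: the time scale without its left-scattered maximum (if there is one). -/
def kappa (T : Set ℝ) : Set ℝ := {t ∈ T | ¬ (IsGreatest T t ∧ rho T t < t)}

/-- `x` has delta derivative `d` at `t`: the limit of `(x(σ(t)) - x(s)) / (σ(t) - s)` as `s → t`
in `T` with `s ≠ σ(t)` is `d`. (The value `s = t` is allowed when `t` is right-scattered.) -/
def HasDeltaDerivAt (T : Set ℝ) (x : ℝ → ℂ) (d : ℂ) (t : ℝ) : Prop :=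
  Tendsto (fun s : ℝ => (x (sigma T t) - x s) / ((sigma T t - s : ℝ) : ℂ))
    (𝓝[T \ {sigma T t}] t) (𝓝 d)

/-- rd-continuity on `T`: continuity at right-dense points and finite left-hand limits at
left-dense points. -/
def RdContinuous (T : Set ℝ) (f : ℝ → ℂ) : Prop :=
  (∀ t ∈ T, sigma T t = t → ContinuousWithinAt f T t) ∧
  (∀ t ∈ T, rho T t = t → ∃ l : ℂ, Tendsto f (𝓝[T ∩ Iio t] t) (𝓝 l))

/-- Regressivity: `μ(t) α(t) ≠ ±2` on `T^κ`. -/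
def Regressive (T : Set ℝ) (α : ℝ → ℂ) : Prop :=
  ∀ t ∈ kappa T, (graininess T t : ℂ) * α t ≠ 2 ∧ (graininess T t : ℂ) * α t ≠ -2

/-- `F` is a delta antiderivative of `f`: `F^Δ = f` on `T^κ`. -/
def IsDeltaAntideriv (T : Set ℝ) (F f : ℝ → ℂ) : Prop :=
  ∀ t ∈ kappa T, HasDeltaDerivAt T F (f t) t

/-- The Cauchy delta integral `∫_a^b f(s) Δs = F(b) - F(a)`, where `F` is a delta antiderivative
of `f` (the value is `0` by convention if there is none). -/
def deltaIntegral (T : Set ℝ) (f : ℝ → ℂ) (a b : ℝ) : ℂ :=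
  open Classical in
  if h : ∃ F : ℝ → ℂ, IsDeltaAntideriv T F f then h.choose b - h.choose a else 0

/-- `ζ_h(z) = (1/h) log ((1 + zh/2) / (1 - zh/2))` for `h ≠ 0`, with the principal logarithm,
and `ζ_0(z) = z`. -/
def zeta (h : ℝ) (z : ℂ) : ℂ :=
  if h = 0 then z
  else (1 / (h : ℂ)) * Complex.log ((1 + 1 / 2 * z * (h : ℂ)) / (1 - 1 / 2 * z * (h : ℂ)))

/-- The Cayley-exponential function `E_α(t, t₀) = exp (∫_{t₀}^t ζ_{μ(s)}(α(s)) Δs)`. -/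
def cayleyExpFrom (T : Set ℝ) (α : ℝ → ℂ) (t t₀ : ℝ) : ℂ :=
  Complex.exp (deltaIntegral T (fun s => zeta (graininess T s) (α s)) t₀ t)

/-- `E_α(t) = E_α(t, 0)`. -/
def cayleyExp (T : Set ℝ) (α : ℝ → ℂ) (t : ℝ) : ℂ := cayleyExpFrom T α t 0

/-- `Cosh_α = (E_α + E_{-α}) / 2`. -/
def cayleyCosh (T : Set ℝ) (α : ℝ → ℂ) (t : ℝ) : ℂ :=
  (cayleyExp T α t + cayleyExp T (-α) t) / 2

/-- `Sinh_α = (E_α - E_{-α}) / 2`. -/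
def cayleySinh (T : Set ℝ) (α : ℝ → ℂ) (t : ℝ) : ℂ :=
  (cayleyExp T α t - cayleyExp T (-α) t) / 2

/-- The average `⟨x(t)⟩ = (x(t) + x(σ(t))) / 2`. -/
def average (T : Set ℝ) (x : ℝ → ℂ) (t : ℝ) : ℂ := (x t + x (sigma T t)) / 2

end TimeScale

end

/-! Everything rests on $E_\alpha^\Delta=\alpha\langle E_\alpha\rangle$
(`hasDeltaDerivAt_cayleyExp`). At a right-dense point this is the chain rule; at a right-scattered
one $E_\alpha$ is multiplied by $(1+\alpha\mu/2)/(1-\alpha\mu/2)$ on passing from $t$ to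
$\sigma(t)$, which is the same equation rearranged. Replacing $\alpha$ by $-\alpha$ inverts this
factor, so $E_\alpha E_{-\alpha}$ has zero delta derivative and is constantly 1
(`eq_of_hasDeltaDerivAt_zero`). As $\mathrm{Cosh}_\alpha^2-\mathrm{Sinh}_\alpha^2=E_\alpha
E_{-\alpha}$, the identity follows; the two derivatives follow by linearity.

The analytic work is to show that $\zeta_\mu(\alpha)$ is rd-continuous and that rd-continuous
functions have delta antiderivatives (`exists_isDeltaAntideriv`), so that `deltaIntegral` is not its
default value 0. -/

namespace TimeScale

variable {T : Set ℝ} {t : ℝ}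

/-! ### Jump operators -/

theorem sigma_le {s : ℝ} (hs : s ∈ T) (hts : t < s) : sigma T t ≤ s := by
  have h : {s ∈ T | t < s}.Nonempty := ⟨s, hs, hts⟩
  rw [sigma, if_pos h]
  exact csInf_le ⟨t, fun u hu => hu.2.le⟩ ⟨hs, hts⟩

theorem sigma_eq_self_of_isGreatest (h : IsGreatest T t) : sigma T t = t := by
  have hne : ¬ {s ∈ T | t < s}.Nonempty := by
    rintro ⟨s, hs, hts⟩
    exact absurd (h.2 hs) (not_le.2 hts)
  rw [sigma, if_neg hne, h.csSup_eq]

theorem isGreatest_of_forall_not_lt (ht : t ∈ T) (h : ¬ ∃ s ∈ T, t < s) : IsGreatest T t :=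
  ⟨ht, fun s hs => not_lt.1 fun hlt => h ⟨s, hs, hlt⟩⟩

theorem le_sigma (ht : t ∈ T) : t ≤ sigma T t := by
  by_cases h : {s ∈ T | t < s}.Nonempty
  · rw [sigma, if_pos h]
    exact le_csInf h fun u hu => hu.2.le
  · exact (sigma_eq_self_of_isGreatest (isGreatest_of_forall_not_lt ht h)).ge

theorem sigma_mem (hT : IsClosed T) (ht : t ∈ T) : sigma T t ∈ T := by
  by_cases h : {s ∈ T | t < s}.Nonempty
  · rw [sigma, if_pos h]
    have hcl := csInf_mem_closure h ⟨t, fun u hu => hu.2.le⟩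
    exact hT.closure_subset (closure_mono (fun u hu => hu.1) hcl)
  · rwa [sigma_eq_self_of_isGreatest (isGreatest_of_forall_not_lt ht h)]

theorem exists_mem_between_of_sigma_eq (h : sigma T t = t) {s c : ℝ} (hs : s ∈ T) (hts : t < s)
    (hc : t < c) : ∃ u ∈ T, t < u ∧ u < c := by
  have hne : {s ∈ T | t < s}.Nonempty := ⟨s, hs, hts⟩
  rw [sigma, if_pos hne] at h
  obtain ⟨u, hu, huc⟩ := exists_lt_of_csInf_lt hne (h.trans_lt hc)
  exact ⟨u, hu.1, hu.2, huc⟩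

theorem le_rho {s : ℝ} (hs : s ∈ T) (hst : s < t) : s ≤ rho T t := by
  have h : {s ∈ T | s < t}.Nonempty := ⟨s, hs, hst⟩
  rw [rho, if_pos h]
  exact le_csSup ⟨t, fun u hu => hu.2.le⟩ ⟨hs, hst⟩

theorem rho_le (ht : t ∈ T) : rho T t ≤ t := by
  by_cases h : {s ∈ T | s < t}.Nonempty
  · rw [rho, if_pos h]
    exact csSup_le h fun u hu => hu.2.le
  · rw [rho, if_neg h]
    exact csInf_le ⟨t, fun s hs => not_lt.1 fun hlt => h ⟨s, hs, hlt⟩⟩ ht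

theorem mem_kappa_of_lt {s : ℝ} (ht : t ∈ T) (hs : s ∈ T) (hts : t < s) : t ∈ kappa T :=
  ⟨ht, fun h => absurd (h.1.2 hs) (not_le.2 hts)⟩

theorem nhdsWithin_inter_Iio_eq_bot (h : rho T t < t) : 𝓝[T ∩ Iio t] t = ⊥ := by
  rw [← empty_mem_iff_bot, mem_nhdsWithin]
  refine ⟨Ioi (rho T t), isOpen_Ioi, h, ?_⟩
  rintro s ⟨hs, hsT, hst⟩
  exact absurd (le_rho hsT hst) (not_le.2 hs)

theorem nhdsWithin_inter_Ioi_eq_bot (h : t < sigma T t) : 𝓝[T ∩ Ioi t] t = ⊥ := by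
  rw [← empty_mem_iff_bot, mem_nhdsWithin]
  refine ⟨Iio (sigma T t), isOpen_Iio, h, ?_⟩
  rintro s ⟨hs, hsT, hst⟩
  exact absurd (sigma_le hsT hst) (not_le.2 hs)

theorem nhdsWithin_eq_sup (ht : t ∈ T) :
    𝓝[T] t = 𝓝[T ∩ Iio t] t ⊔ pure t ⊔ 𝓝[T ∩ Ioi t] t := by
  have h : T = T ∩ Iio t ∪ {t} ∪ T ∩ Ioi t := by
    ext s
    rcases lt_trichotomy s t with h | rfl | h
    · simp [h, h.ne, h.not_gt]
    · simp [ht]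
    · simp [h, h.ne', h.not_gt]
  conv_lhs => rw [h]
  rw [nhdsWithin_union, nhdsWithin_union, nhdsWithin_singleton]

/-- Such a point is isolated in `T`. -/
theorem continuousWithinAt_of_notMem_kappa {x : ℝ → ℂ} (ht : t ∈ T) (h : t ∉ kappa T) :
    ContinuousWithinAt x T t := by
  have h' : IsGreatest T t ∧ rho T t < t := by
    by_contra hn
    exact h ⟨ht, hn⟩
  have hr : T ∩ Ioi t = ∅ := by
    ext s
    simpa using fun hs => h'.1.2 hs
  rw [ContinuousWithinAt, nhdsWithin_eq_sup ht, nhdsWithin_inter_Iio_eq_bot h'.2, hr]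
  simpa using tendsto_pure_nhds x t

theorem tendsto_sigma (ht : t ∈ T) (h : sigma T t = t) :
    Tendsto (sigma T) (𝓝[T] t) (𝓝 t) := by
  rw [tendsto_order]
  constructor
  · intro a ha
    filter_upwards [self_mem_nhdsWithin, mem_nhdsWithin_of_mem_nhds (Ioi_mem_nhds ha)] with s hs has
    exact lt_of_lt_of_le has (le_sigma hs)
  · intro b hb
    by_cases hex : ∃ s ∈ T, t < s
    · obtain ⟨s, hs, hts⟩ := hex
      obtain ⟨u, hu, htu, hub⟩ := exists_mem_between_of_sigma_eq h hs hts hb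
      filter_upwards [mem_nhdsWithin_of_mem_nhds (Iio_mem_nhds htu)] with s hs
      exact (sigma_le hu hs).trans_lt hub
    · filter_upwards [self_mem_nhdsWithin] with s hs
      rcases lt_or_ge s t with hst | hst
      · exact (sigma_le ht hst).trans_lt hb
      · have hst' : s = t := le_antisymm ((isGreatest_of_forall_not_lt ht hex).2 hs) hst
        rw [hst', h]
        exact hb

/-- For $s<t$ in `T`, $\sigma(s)$ is squeezed between $s$ and $t$. Hence the graininess tends to 0
from the left even if $t$ is right-scattered. -/
theorem tendsto_sigma_left (ht : t ∈ T) : Tendsto (sigma T) (𝓝[T ∩ Iio t] t) (𝓝 t) := by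
  refine tendsto_of_tendsto_of_tendsto_of_le_of_le'
    (tendsto_id.mono_left nhdsWithin_le_nhds) tendsto_const_nhds ?_ ?_
  · filter_upwards [self_mem_nhdsWithin] with s hs using le_sigma hs.1
  · filter_upwards [self_mem_nhdsWithin] with s hs using sigma_le ht hs.2

/-! ### Delta derivatives -/

theorem hasDeltaDerivAt_iff_of_sigma_eq {x : ℝ → ℂ} {d : ℂ} (h : sigma T t = t) :
    HasDeltaDerivAt T x d t ↔ HasDerivWithinAt x d T t := by
  rw [HasDeltaDerivAt, hasDerivWithinAt_iff_tendsto_slope, h]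
  refine tendsto_congr fun s => ?_
  rw [slope_def_module, Complex.real_smul, ← neg_sub s t, ← neg_sub (x s) (x t),
    Complex.ofReal_neg, neg_div_neg_eq, div_eq_inv_mul, Complex.ofReal_inv]

theorem hasDeltaDerivAt_iff_of_lt_sigma {x : ℝ → ℂ} {d : ℂ} (ht : t ∈ T) (h : t < sigma T t) :
    HasDeltaDerivAt T x d t ↔
      ContinuousWithinAt x T t ∧ x (sigma T t) - x t = (graininess T t : ℂ) * d := by
  have hne : ∀ s, s ≠ sigma T t → ((sigma T t - s : ℝ) : ℂ) ≠ 0 := fun s hs =>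
    Complex.ofReal_ne_zero.2 (sub_ne_zero.2 hs.symm)
  have hnhds : 𝓝[T \ {sigma T t}] t = 𝓝[T] t := by
    rw [sdiff_eq, nhdsWithin_inter_of_mem']
    exact mem_nhdsWithin_of_mem_nhds (isOpen_ne.mem_nhds h.ne)
  have hcont : Tendsto (fun s : ℝ => ((sigma T t - s : ℝ) : ℂ)) (𝓝[T] t)
      (𝓝 ((sigma T t - t : ℝ) : ℂ)) :=
    (Continuous.tendsto (by fun_prop) t).mono_left nhdsWithin_le_nhds
  rw [HasDeltaDerivAt, hnhds, graininess]
  constructor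
  · intro hx
    -- Here $t$ belongs to the set along which the limit is taken, so the limit is the value of the
    -- quotient at $t$.
    have hval : (x (sigma T t) - x t) / ((sigma T t - t : ℝ) : ℂ) = d :=
      tendsto_nhds_unique (tendsto_pure_nhds _ t) (hx.mono_left (pure_le_nhdsWithin ht))
    have heq : x (sigma T t) - x t = ((sigma T t - t : ℝ) : ℂ) * d := by
      rw [← hval, mul_div_cancel₀ _ (hne t h.ne)]
    refine ⟨?_, heq⟩
    have hlim := (tendsto_const_nhds (x := x (sigma T t))).sub (hcont.mul hx)
    rw [← heq, sub_sub_cancel] at hlim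
    refine hlim.congr' ?_
    filter_upwards [mem_nhdsWithin_of_mem_nhds (isOpen_ne.mem_nhds h.ne)] with s hs
    rw [mul_div_cancel₀ _ (hne s hs), sub_sub_cancel]
  · rintro ⟨hc, heq⟩
    have hlim := ((tendsto_const_nhds (x := x (sigma T t))).sub hc).div hcont (hne t h.ne)
    rwa [heq, mul_div_cancel_left₀ _ (hne t h.ne)] at hlim

theorem HasDeltaDerivAt.continuousWithinAt {x : ℝ → ℂ} {d : ℂ} (ht : t ∈ T)
    (h : HasDeltaDerivAt T x d t) : ContinuousWithinAt x T t := by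
  rcases (le_sigma ht).eq_or_lt with hs | hs
  · exact ((hasDeltaDerivAt_iff_of_sigma_eq hs.symm).1 h).continuousWithinAt
  · exact ((hasDeltaDerivAt_iff_of_lt_sigma ht hs).1 h).1

theorem HasDeltaDerivAt.sigma_sub {x : ℝ → ℂ} {d : ℂ} (ht : t ∈ T)
    (h : HasDeltaDerivAt T x d t) : x (sigma T t) - x t = (graininess T t : ℂ) * d := by
  rcases (le_sigma ht).eq_or_lt with hs | hs
  · simp [graininess, ← hs]
  · exact ((hasDeltaDerivAt_iff_of_lt_sigma ht hs).1 h).2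

/-- A function on a time scale whose delta derivative vanishes is constant. -/
theorem eq_of_hasDeltaDerivAt_zero (hT : IsClosed T) {x : ℝ → ℂ}
    (hx : ∀ t ∈ kappa T, HasDeltaDerivAt T x 0 t) {a b : ℝ} (ha : a ∈ T) (hb : b ∈ T)
    (hab : a ≤ b) : x b = x a := by
  have hcont : ContinuousOn x T := fun t ht => by
    by_cases hk : t ∈ kappa T
    · exact (hx t hk).continuousWithinAt ht
    · exact continuousWithinAt_of_notMem_kappa ht hk
  -- Real induction: the last point $c$ of `S` must be $b$. Otherwise the slack `ε` gives a later
  -- point of `S` when $c$ is right-dense, and $x(\sigma(c))=x(c)$ does so when $c$ is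
  -- right-scattered.
  have key : ∀ ε > 0, ‖x b - x a‖ ≤ ε * (b - a) := by
    intro ε hε
    let S : Set ℝ := {s ∈ T ∩ Icc a b | ‖x s - x a‖ ≤ ε * (s - a)}
    have hcl : IsClosed S := by
      have hc : ContinuousOn x (T ∩ Icc a b) := hcont.mono inter_subset_left
      exact (hT.inter isClosed_Icc).isClosed_le (by fun_prop) (by fun_prop)
    have hcomp : IsCompact S :=
      isCompact_Icc.of_isClosed_subset hcl fun s hs => hs.1.2
    have haS : a ∈ S := ⟨⟨ha, le_rfl, hab⟩, by simp⟩
    obtain ⟨c, hcS, hmax⟩ := hcomp.exists_isGreatest ⟨a, haS⟩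
    obtain ⟨⟨hcT, hac, hcb⟩, hc⟩ := hcS
    rcases hcb.eq_or_lt with rfl | hcb
    · exact hc
    exfalso
    have hck := mem_kappa_of_lt hcT hb hcb
    have hd := hx c hck
    rcases (le_sigma hcT).eq_or_lt with hs | hs
    · have hder := (hasDeltaDerivAt_iff_of_sigma_eq hs.symm).1 hd
      have hlit := (hasDerivWithinAt_iff_isLittleO.1 hder).def hε
      obtain ⟨u, hu, hball⟩ := mem_nhdsWithin.1 hlit
      obtain ⟨e, he, hsub⟩ := exists_Ico_subset_of_mem_nhds (hu.mem_nhds hball.1) ⟨b, hcb⟩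
      obtain ⟨s, hsT, hcs, hse⟩ :=
        exists_mem_between_of_sigma_eq hs.symm hb hcb (lt_min he hcb)
      have hest := hball.2 ⟨hsub ⟨hcs.le, hse.trans_le (min_le_left _ _)⟩, hsT⟩
      simp only [smul_zero, sub_zero, Real.norm_eq_abs, abs_of_pos (sub_pos.2 hcs),
        mem_ofPred_eq] at hest
      have hsS : s ∈ S := by
        refine ⟨⟨hsT, hac.trans hcs.le, (hse.trans_le (min_le_right _ _)).le⟩, ?_⟩
        calc ‖x s - x a‖ ≤ ‖x s - x c‖ + ‖x c - x a‖ := norm_sub_le_norm_sub_add_norm_sub ..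
          _ ≤ ε * (s - c) + ε * (c - a) := add_le_add hest hc
          _ = ε * (s - a) := by ring
      exact absurd (hmax hsS) (not_le.2 hcs)
    · have heq := hd.sigma_sub hcT
      rw [mul_zero, sub_eq_zero] at heq
      have hsS : sigma T c ∈ S := by
        refine ⟨⟨sigma_mem hT hcT, hac.trans hs.le, sigma_le hb hcb⟩, ?_⟩
        rw [heq]
        exact hc.trans (by gcongr)
      exact absurd (hmax hsS) (not_le.2 hs)
  have hle : ‖x b - x a‖ ≤ 0 := by
    have hlim : Tendsto (fun ε : ℝ => ε * (b - a)) (𝓝[>] 0) (𝓝 0) := by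
      have := (Continuous.tendsto (f := fun ε : ℝ => ε * (b - a)) (by fun_prop) 0).mono_left
        (nhdsWithin_le_nhds (s := Ioi 0))
      simpa using this
    refine ge_of_tendsto hlim ?_
    filter_upwards [self_mem_nhdsWithin] with ε hε using key ε hε
  exact sub_eq_zero.1 (norm_le_zero_iff.1 hle)

/-! ### The cylinder transformation -/

theorem tendsto_zeta {ι : Type*} {l : Filter ι} {h : ι → ℝ} {a : ι → ℂ} {z : ℂ}
    (hh : Tendsto h l (𝓝 0)) (ha : Tendsto a l (𝓝 z)) :
    Tendsto (fun i => zeta (h i) (a i)) l (𝓝 z) := by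
  -- With $q=z/(1-zh/2)$ the argument of the logarithm is $1+hq$, so $\zeta_h(z)=q\,k(hq)$, also for
  -- $h=0$. Then $k\to1$ at 0 gives the limit.
  let k : ℂ → ℂ := dslope (fun w => Complex.log (1 + w)) 0
  have hlog : HasDerivAt (fun w : ℂ => Complex.log (1 + w)) 1 0 := by
    have h1 : (1 : ℂ) + 0 ∈ Complex.slitPlane := by simp
    simpa using ((hasDerivAt_id (0 : ℂ)).const_add 1).clog h1
  have hk0 : k 0 = 1 := by
    simp only [k, dslope_same, hlog.deriv]
  have hkc : Tendsto k (𝓝 0) (𝓝 1) := by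
    have := continuousAt_dslope_same.2 hlog.differentiableAt
    rw [ContinuousAt] at this
    rwa [← hk0]
  have hk : ∀ w, Complex.log (1 + w) = w * k w := by
    intro w
    simpa using (sub_smul_dslope (fun w => Complex.log (1 + w)) 0 w).symm
  have hhC : Tendsto (fun i => (h i : ℂ)) l (𝓝 0) := by
    exact (Complex.continuous_ofReal.tendsto' 0 0 Complex.ofReal_zero).comp hh
  have hden : Tendsto (fun i => 1 - 1 / 2 * a i * (h i : ℂ)) l (𝓝 1) := by
    have hprod := (ha.const_mul (1 / 2)).mul hhC
    rw [mul_zero] at hprod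
    have hsub := (tendsto_const_nhds (x := (1 : ℂ))).sub hprod
    rwa [sub_zero] at hsub
  have hquot : Tendsto (fun i => a i / (1 - 1 / 2 * a i * (h i : ℂ))) l (𝓝 z) := by
    have hdiv := ha.div hden one_ne_zero
    rwa [div_one] at hdiv
  have harg : Tendsto (fun i => (h i : ℂ) * (a i / (1 - 1 / 2 * a i * (h i : ℂ)))) l (𝓝 0) := by
    have hprod := hhC.mul hquot
    rwa [zero_mul] at hprod
  have hlim := hquot.mul (hkc.comp harg)
  rw [mul_one] at hlim
  refine hlim.congr' ?_
  filter_upwards [hden.eventually_ne one_ne_zero] with i hi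
  simp only [Function.comp_apply]
  by_cases hi0 : h i = 0
  · simp [zeta, hi0, hk0]
  · have hiC : (h i : ℂ) ≠ 0 := Complex.ofReal_ne_zero.2 hi0
    have hrw : (1 + 1 / 2 * a i * (h i : ℂ)) / (1 - 1 / 2 * a i * (h i : ℂ)) =
        1 + (h i : ℂ) * (a i / (1 - 1 / 2 * a i * (h i : ℂ))) := by
      rw [← mul_div_assoc, div_eq_iff hi, add_mul, div_mul_cancel₀ _ hi]
      ring
    rw [zeta, if_neg hi0, hrw, hk, mul_assoc (h i : ℂ), ← mul_assoc (1 / (h i : ℂ)),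
      one_div_mul_cancel hiC, one_mul]

theorem RdContinuous.zeta_graininess {α : ℝ → ℂ} (hα : RdContinuous T α) :
    RdContinuous T fun s => zeta (graininess T s) (α s) := by
  constructor
  · intro t ht hs
    have hg : Tendsto (graininess T) (𝓝[T] t) (𝓝 0) := by
      simpa [Function.comp_def, funext fun s => graininess.eq_1 T s] using (tendsto_sigma ht hs).sub (tendsto_id.mono_left nhdsWithin_le_nhds)
    have hz : zeta (graininess T t) (α t) = α t := by simp [zeta, graininess, hs]
    rw [ContinuousWithinAt, hz]
    exact tendsto_zeta hg (hα.1 t ht hs)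
  · intro t ht hr
    obtain ⟨l, hl⟩ := hα.2 t ht hr
    have hg : Tendsto (graininess T) (𝓝[T ∩ Iio t] t) (𝓝 0) := by
      simpa [Function.comp_def, funext fun s => graininess.eq_1 T s] using (tendsto_sigma_left ht).sub (tendsto_id.mono_left nhdsWithin_le_nhds)
    exact ⟨l, tendsto_zeta hg hl⟩

/-! ### Existence of delta antiderivatives -/

/-- Local bounds combine by compactness. At a right-scattered point only the left side matters,
where there is a limit or no nearby point. -/
theorem RdContinuous.exists_norm_le (hT : IsClosed T) {f : ℝ → ℂ} (hf : RdContinuous T f)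
    (a b : ℝ) : ∃ C, ∀ s ∈ T ∩ Icc a b, ‖f s‖ ≤ C := by
  have hloc : ∀ t ∈ T, ∃ C, ∀ᶠ s in 𝓝[T] t, ‖f s‖ ≤ C := by
    intro t ht
    rcases (le_sigma ht).eq_or_lt with hs | hs
    · exact (hf.1 t ht hs.symm).norm.isBoundedUnder_le
    · have hleft : ∃ C, ∀ᶠ s in 𝓝[T ∩ Iio t] t, ‖f s‖ ≤ C := by
        rcases (rho_le ht).eq_or_lt with hr | hr
        · obtain ⟨l, hl⟩ := hf.2 t ht hr
          exact hl.norm.isBoundedUnder_le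
        · exact ⟨0, by simp [nhdsWithin_inter_Iio_eq_bot hr]⟩
      obtain ⟨C, hC⟩ := hleft
      refine ⟨max C ‖f t‖, ?_⟩
      rw [nhdsWithin_eq_sup ht, nhdsWithin_inter_Ioi_eq_bot hs, sup_bot_eq, eventually_sup,
        eventually_pure]
      exact ⟨hC.mono fun s hs => hs.trans (le_max_left _ _), le_max_right _ _⟩
  refine (isCompact_Icc.inter_left hT).induction_on
    (p := fun s : Set ℝ => ∃ C, ∀ u ∈ s, ‖f u‖ ≤ C) ⟨0, by simp⟩ ?_ ?_ ?_
  · rintro s u hsu ⟨C, hC⟩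
    exact ⟨C, fun v hv => hC v (hsu hv)⟩
  · intro s u hs hu
    obtain ⟨C, hC⟩ := hs
    obtain ⟨D, hD⟩ := hu
    refine ⟨max C D, fun v hv => ?_⟩
    rcases hv with hv | hv
    · exact (hC v hv).trans (le_max_left _ _)
    · exact (hD v hv).trans (le_max_right _ _)
  · intro t ht
    obtain ⟨C, hC⟩ := hloc t ht.1
    exact ⟨{u | ‖f u‖ ≤ C}, nhdsWithin_mono t inter_subset_left hC, C, fun v hv => hv⟩

theorem countable_lt_sigma : {t ∈ T | t < sigma T t}.Countable :=
  (countable_setOfPred_isolated_right_within (s := T)).mono (by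
    rintro t ⟨ht, hlt⟩
    exact ⟨ht, nhdsWithin_inter_Ioi_eq_bot hlt⟩)

/-- Off the countable set of right-scattered points, `f` is continuous on `T`. -/
theorem RdContinuous.measurable_indicator (hT : IsClosed T) {f : ℝ → ℂ}
    (hf : RdContinuous T f) : Measurable (T.indicator f) := by
  classical
  let D : Set ℝ := T \ {t ∈ T | t < sigma T t}
  have hD : MeasurableSet D := hT.measurableSet.diff countable_lt_sigma.measurableSet
  have hcont : ContinuousOn f D := fun t ht => by
    refine (hf.1 t ht.1 ?_).mono sdiff_subset
    exact ((le_sigma ht.1).eq_or_lt.resolve_right fun h => ht.2 ⟨ht.1, h⟩).symm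
  have hmeas : Measurable (D.indicator f) := by
    rw [← piecewise_eq_indicator]
    exact hcont.measurable_piecewise continuousOn_const hD
  refine hmeas.measurable_of_countable_ne ((countable_lt_sigma (T := T)).mono fun t ht => ?_)
  by_contra hn
  apply ht
  by_cases htT : t ∈ T
  · rw [indicator_of_mem htT, indicator_of_mem (show t ∈ D from ⟨htT, hn⟩)]
  · rw [indicator_of_notMem htT, indicator_of_notMem fun h : t ∈ D => htT h.1]

/-- The largest point of `T` that is at most `u`. -/
noncomputable def floorPt (T : Set ℝ) (u : ℝ) : ℝ := sSup (T ∩ Iic u)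

theorem floorPt_mem (hT : IsClosed T) {a u : ℝ} (ha : a ∈ T) (hau : a ≤ u) :
    floorPt T u ∈ T ∩ Icc a u := by
  have hbdd : BddAbove (T ∩ Iic u) := ⟨u, fun s hs => hs.2⟩
  have hmem := (hT.inter isClosed_Iic).csSup_mem ⟨a, ha, hau⟩ hbdd
  exact ⟨hmem.1, le_csSup hbdd ⟨ha, hau⟩, hmem.2⟩

theorem floorPt_eq (hT : IsClosed T) {u : ℝ} (ht : t ∈ T) (htu : t ≤ u) (hu : u < sigma T t) :
    floorPt T u = t := by
  obtain ⟨hmem, hle, hle'⟩ := floorPt_mem hT ht htu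
  refine le_antisymm (not_lt.1 fun hlt => ?_) hle
  exact absurd ((sigma_le hmem hlt).trans hle') (not_le.2 hu)

theorem monotoneOn_floorPt {a : ℝ} (ha : a ∈ T) : MonotoneOn (floorPt T) (Ici a) :=
  fun _ hu v _ huv => csSup_le_csSup ⟨v, fun _ hs => hs.2⟩ ⟨a, ha, hu⟩
    (inter_subset_inter_right _ (Iic_subset_Iic.2 huv))

/-- Composing with `floorPt` extends `f` across each gap $[t,\sigma(t))$ by the constant $f(t)$; the
Lebesgue integral of this extension will be the antiderivative. -/
theorem RdContinuous.intervalIntegrable (hT : IsClosed T) {f : ℝ → ℂ} (hf : RdContinuous T f)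
    {a b : ℝ} (ha : a ∈ T) (hb : b ∈ T) :
    IntervalIntegrable (fun u => f (floorPt T u)) MeasureTheory.volume a b := by
  wlog hab : a ≤ b generalizing a b
  · exact (this hb ha (le_of_not_ge hab)).symm
  obtain ⟨C, hC⟩ := hf.exists_norm_le hT a b
  rw [intervalIntegrable_iff_integrableOn_Icc_of_le hab]
  have hfloor : AEMeasurable (floorPt T) (MeasureTheory.volume.restrict (Icc a b)) :=
    aemeasurable_restrict_of_monotoneOn measurableSet_Icc
      ((monotoneOn_floorPt ha).mono Icc_subset_Ici_self)
  have hmeas : MeasureTheory.AEStronglyMeasurable (fun u => f (floorPt T u))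
      (MeasureTheory.volume.restrict (Icc a b)) := by
    refine ((hf.measurable_indicator hT).comp_aemeasurable
      hfloor).aestronglyMeasurable.congr ?_
    filter_upwards [MeasureTheory.ae_restrict_mem measurableSet_Icc] with u hu
    exact indicator_of_mem (floorPt_mem hT ha hu.1).1 f
  refine ⟨hmeas, MeasureTheory.HasFiniteIntegral.restrict_of_bounded (C := C)
    measure_Icc_lt_top ?_⟩
  filter_upwards [MeasureTheory.ae_restrict_mem measurableSet_Icc] with u hu
  obtain ⟨hmem, hle, hle'⟩ := floorPt_mem hT ha hu.1
  exact hC _ ⟨hmem, hle, hle'.trans hu.2⟩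

theorem exists_isDeltaAntideriv (hT : IsClosed T) {f : ℝ → ℂ} (hf : RdContinuous T f)
    {t₀ : ℝ} (ht₀ : t₀ ∈ T) : ∃ F, IsDeltaAntideriv T F f := by
  let g : ℝ → ℂ := fun u => f (floorPt T u)
  have hint : ∀ {a b}, a ∈ T → b ∈ T → IntervalIntegrable g MeasureTheory.volume a b :=
    fun ha hb => hf.intervalIntegrable hT ha hb
  let F : ℝ → ℂ := fun t => ∫ u in t₀..t, g u
  have hsub : ∀ {a b}, a ∈ T → b ∈ T → F b - F a = ∫ u in a..b, g u := fun ha hb =>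
    intervalIntegral.integral_interval_sub_left (hint ht₀ hb) (hint ht₀ ha)
  refine ⟨F, fun t htk => ?_⟩
  have ht : t ∈ T := htk.1
  rcases (le_sigma ht).eq_or_lt with hs | hs
  · rw [hasDeltaDerivAt_iff_of_sigma_eq hs.symm, hasDerivWithinAt_iff_isLittleO,
      Asymptotics.isLittleO_iff]
    intro ε hε
    obtain ⟨δ, hδ, hball⟩ := Metric.continuousWithinAt_iff.1 (hf.1 t ht hs.symm) ε hε
    filter_upwards [self_mem_nhdsWithin, mem_nhdsWithin_of_mem_nhds (Metric.ball_mem_nhds t hδ)]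
      with s hsT hsδ
    have hconst : (s - t) • f t = ∫ _ in t..s, f t := by
      rw [intervalIntegral.integral_const]
    rw [hsub ht hsT, hconst, ← intervalIntegral.integral_sub (hint ht hsT)
      intervalIntegrable_const]
    refine intervalIntegral.norm_integral_le_of_norm_le_const fun u hu => ?_
    -- Since `min t s` lies in `T`, rounding `u` down to `T` cannot leave the interval between `t`
    -- and `s`.
    have hmin : min t s ∈ T := by rcases min_choice t s with h | h <;> rw [h] <;> assumption
    obtain ⟨hmem, hle, hle'⟩ := floorPt_mem hT hmin hu.1.le
    have hdist : dist (floorPt T u) t < δ := by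
      refine lt_of_le_of_lt ?_ (Metric.mem_ball.1 hsδ)
      rw [Real.dist_eq, Real.dist_eq]
      exact abs_sub_left_of_mem_uIcc ⟨hle, hle'.trans hu.2⟩
    have := hball hmem hdist
    rw [dist_eq_norm] at this
    exact this.le
  · have hσ := sigma_mem hT ht
    rw [hasDeltaDerivAt_iff_of_lt_sigma ht hs]
    constructor
    · obtain ⟨C, hC⟩ := hf.exists_norm_le hT (t - 1) (t + 1)
      rw [ContinuousWithinAt, tendsto_iff_norm_sub_tendsto_zero]
      have hlim : Tendsto (fun s => C * |s - t|) (𝓝[T] t) (𝓝 0) := by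
        have := (Continuous.tendsto (f := fun s => C * |s - t|) (by fun_prop) t).mono_left
          (nhdsWithin_le_nhds (s := T))
        simpa using this
      refine squeeze_zero' (Eventually.of_forall fun s => norm_nonneg _) ?_ hlim
      filter_upwards [self_mem_nhdsWithin,
        mem_nhdsWithin_of_mem_nhds (Icc_mem_nhds (sub_one_lt t) (lt_add_one t))] with s hsT hs1
      rw [hsub ht hsT]
      refine intervalIntegral.norm_integral_le_of_norm_le_const fun u hu => ?_
      have hmin : min t s ∈ T := by rcases min_choice t s with h | h <;> rw [h] <;> assumption
      obtain ⟨hmem, hle, hle'⟩ := floorPt_mem hT hmin hu.1.le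
      refine hC _ ⟨hmem, (le_min (sub_one_lt t).le hs1.1).trans hle, ?_⟩
      exact (hle'.trans hu.2).trans (max_le (lt_add_one t).le hs1.2)
    · have hcongr : ∫ u in t..sigma T t, g u = ∫ _ in t..sigma T t, f t := by
        refine intervalIntegral.integral_congr_Ioo_of_le hs.le fun u hu => ?_
        simp only [g, floorPt_eq hT ht hu.1.le hu.2]
      rw [hsub ht hσ, hcongr, intervalIntegral.integral_const, Complex.real_smul, graininess]

/-! ### The Cayley exponential -/

theorem Regressive.neg {α : ℝ → ℂ} (h : Regressive T α) : Regressive T (-α) := by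
  intro t ht
  obtain ⟨h1, h2⟩ := h t ht
  simp only [Pi.neg_apply, mul_neg]
  exact ⟨fun h => h2 (by rw [← h, neg_neg]), fun h => h1 (neg_injective h)⟩

theorem RdContinuous.neg {α : ℝ → ℂ} (h : RdContinuous T α) : RdContinuous T (-α) :=
  ⟨fun t ht hs => (h.1 t ht hs).neg, fun t ht hr => (h.2 t ht hr).imp' (fun l => -l)
    fun _ hl => hl.neg⟩

/-- Regressivity keeps numerator and denominator nonzero, so `exp` undoes the logarithm whatever the
branch. -/
theorem exp_mul_zeta {h : ℝ} {z : ℂ} (hh : h ≠ 0) (h1 : (h : ℂ) * z ≠ 2) (h2 : (h : ℂ) * z ≠ -2) :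
    Complex.exp (h * zeta h z) * (1 - 1 / 2 * z * h) = 1 + 1 / 2 * z * h := by
  have hhC : (h : ℂ) ≠ 0 := Complex.ofReal_ne_zero.2 hh
  have hden : 1 - 1 / 2 * z * (h : ℂ) ≠ 0 := fun h0 => h1 (by linear_combination (-2) * h0)
  have hnum : 1 + 1 / 2 * z * (h : ℂ) ≠ 0 := fun h0 => h2 (by linear_combination 2 * h0)
  rw [zeta, if_neg hh, ← mul_assoc, mul_one_div_cancel hhC, one_mul,
    Complex.exp_log (div_ne_zero hnum hden), div_mul_cancel₀ _ hden]

theorem cayleyExp_zero (α : ℝ → ℂ) : cayleyExp T α 0 = 1 := by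
  rw [cayleyExp, cayleyExpFrom, deltaIntegral]
  split_ifs <;> simp

/-- The Cayley exponential solves `x^Δ = α ⟨x⟩`. -/
theorem hasDeltaDerivAt_cayleyExp (hT : IsClosed T) (h0 : (0 : ℝ) ∈ T) {α : ℝ → ℂ}
    (hrd : RdContinuous T α) (hreg : Regressive T α) (ht : t ∈ kappa T) :
    HasDeltaDerivAt T (cayleyExp T α) (α t * average T (cayleyExp T α) t) t := by
  -- Any antiderivative serves, so the one picked by choice needs no uniqueness argument.
  obtain ⟨F, hF, hE⟩ : ∃ F, IsDeltaAntideriv T F (fun s => zeta (graininess T s) (α s)) ∧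
      cayleyExp T α = fun t => Complex.exp (F t - F 0) := by
    have hex := exists_isDeltaAntideriv hT (hrd.zeta_graininess) h0
    refine ⟨hex.choose, hex.choose_spec, funext fun t => ?_⟩
    rw [cayleyExp, cayleyExpFrom, deltaIntegral, dif_pos hex]
  have hd := hF t ht
  rcases (le_sigma ht.1).eq_or_lt with hs | hs
  · have hμ : graininess T t = 0 := by rw [graininess, ← hs, sub_self]
    rw [hasDeltaDerivAt_iff_of_sigma_eq hs.symm] at hd ⊢
    have hexp := (hd.sub_const (F 0)).cexp
    rw [hE, average, ← hs]
    convert hexp using 1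
    simp only [zeta, hμ, if_true]
    ring
  · have hμ : graininess T t ≠ 0 := (sub_pos.2 hs).ne'
    rw [hasDeltaDerivAt_iff_of_lt_sigma ht.1 hs] at hd ⊢
    obtain ⟨hc, heq⟩ := hd
    have hz := exp_mul_zeta hμ (hreg t ht).1 (hreg t ht).2
    have hσ : F (sigma T t) - F 0 =
        (F t - F 0) + (graininess T t : ℂ) * zeta (graininess T t) (α t) := by
      rw [← heq]
      ring
    rw [hE]
    refine ⟨(hc.sub continuousWithinAt_const).cexp, ?_⟩
    simp only [average, hσ, Complex.exp_add]
    linear_combination Complex.exp (F t - F 0) * hz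

/-- Oddness of $\zeta_h$ is not available: it fails when the argument of the principal logarithm is
a negative real. The product is differentiated instead. -/
theorem cayleyExp_mul_cayleyExp_neg (hT : IsClosed T) (h0 : (0 : ℝ) ∈ T) {α : ℝ → ℂ}
    (hrd : RdContinuous T α) (hreg : Regressive T α) (ht : t ∈ T) :
    cayleyExp T α t * cayleyExp T (-α) t = 1 := by
  have hder : ∀ t ∈ kappa T,
      HasDeltaDerivAt T (fun t => cayleyExp T α t * cayleyExp T (-α) t) 0 t := by
    intro t ht
    have hp := hasDeltaDerivAt_cayleyExp hT h0 hrd hreg ht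
    have hm := hasDeltaDerivAt_cayleyExp hT h0 hrd.neg hreg.neg ht
    rcases (le_sigma ht.1).eq_or_lt with hs | hs
    · rw [hasDeltaDerivAt_iff_of_sigma_eq hs.symm] at hp hm ⊢
      have hmul := hp.fun_mul hm
      have hzero : α t * average T (cayleyExp T α) t * cayleyExp T (-α) t +
          cayleyExp T α t * ((-α) t * average T (cayleyExp T (-α)) t) = 0 := by
        simp only [average, ← hs, Pi.neg_apply]
        ring
      rwa [hzero] at hmul
    · rw [hasDeltaDerivAt_iff_of_lt_sigma ht.1 hs] at hp hm ⊢
      refine ⟨hp.1.mul hm.1, ?_⟩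
      obtain ⟨h1, h2⟩ := hreg t ht
      have h3 := mul_ne_zero (sub_ne_zero.2 h1) (sub_ne_zero.2 h2)
      have hp2 := hp.2
      have hm2 := hm.2
      simp only [average, Pi.neg_apply] at hp2 hm2
      rw [mul_zero]
      -- The goal is multiplied by $(\mu\alpha)^2-4\ne0$ to clear the denominators of the two jump
      -- factors.
      refine (mul_eq_zero.1 ?_).resolve_left h3
      generalize cayleyExp T α (sigma T t) = x' at *
      generalize cayleyExp T α t = x at *
      generalize cayleyExp T (-α) (sigma T t) = y' at *
      generalize cayleyExp T (-α) t = y at *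
      generalize (graininess T t : ℂ) = m at *
      generalize α t = a at *
      have hx : x' * (2 - m * a) = x * (2 + m * a) := by linear_combination 2 * hp2
      have hy : y' * (2 + m * a) = y * (2 - m * a) := by linear_combination 2 * hm2
      linear_combination (-y' * (2 + m * a)) * hx - x * (2 + m * a) * hy
  have hz : cayleyExp T α 0 * cayleyExp T (-α) 0 = 1 := by simp [cayleyExp_zero]
  rcases le_total 0 t with h | h
  · exact (eq_of_hasDeltaDerivAt_zero hT hder h0 ht h).trans hz
  · exact (eq_of_hasDeltaDerivAt_zero hT hder ht h0 h).symm.trans hz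

/-! ### Linearity and the hyperbolic functions -/

theorem HasDeltaDerivAt.add_div_two {x y : ℝ → ℂ} {c d : ℂ} (hx : HasDeltaDerivAt T x c t)
    (hy : HasDeltaDerivAt T y d t) :
    HasDeltaDerivAt T (fun s => (x s + y s) / 2) ((c + d) / 2) t := by
  refine ((hx.add hy).div_const 2).congr fun s => ?_
  ring

theorem HasDeltaDerivAt.sub_div_two {x y : ℝ → ℂ} {c d : ℂ} (hx : HasDeltaDerivAt T x c t)
    (hy : HasDeltaDerivAt T y d t) :
    HasDeltaDerivAt T (fun s => (x s - y s) / 2) ((c - d) / 2) t := by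
  refine ((hx.sub hy).div_const 2).congr fun s => ?_
  ring

end TimeScale

theorem theorem3p19 (T : Set ℝ) (hT : IsClosed T) (h0 : (0 : ℝ) ∈ T) (α : ℝ → ℂ)
    (hrd : TimeScale.RdContinuous T α) (hreg : TimeScale.Regressive T α) :
    (∀ t ∈ T, TimeScale.cayleyCosh T α t ^ 2 - TimeScale.cayleySinh T α t ^ 2 = 1) ∧
    (∀ t ∈ TimeScale.kappa T,
      TimeScale.HasDeltaDerivAt T (TimeScale.cayleyCosh T α)
        (α t * TimeScale.average T (TimeScale.cayleySinh T α) t) t) ∧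
    (∀ t ∈ TimeScale.kappa T,
      TimeScale.HasDeltaDerivAt T (TimeScale.cayleySinh T α)
        (α t * TimeScale.average T (TimeScale.cayleyCosh T α) t) t) := by
  refine ⟨fun t ht => ?_, fun t ht => ?_, fun t ht => ?_⟩
  · have h := TimeScale.cayleyExp_mul_cayleyExp_neg hT h0 hrd hreg ht
    rw [TimeScale.cayleyCosh, TimeScale.cayleySinh]
    linear_combination h
  · have hp := TimeScale.hasDeltaDerivAt_cayleyExp hT h0 hrd hreg ht
    have hm := TimeScale.hasDeltaDerivAt_cayleyExp hT h0 hrd.neg hreg.neg ht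
    refine (congrArg (fun d => TimeScale.HasDeltaDerivAt T (TimeScale.cayleyCosh T α) d t) ?_).mp
      (hp.add_div_two hm)
    simp only [TimeScale.average, TimeScale.cayleySinh, Pi.neg_apply]
    ring
  · have hp := TimeScale.hasDeltaDerivAt_cayleyExp hT h0 hrd hreg ht
    have hm := TimeScale.hasDeltaDerivAt_cayleyExp hT h0 hrd.neg hreg.neg ht
    refine (congrArg (fun d => TimeScale.HasDeltaDerivAt T (TimeScale.cayleySinh T α) d t) ?_).mp
      (hp.sub_div_two hm)
    simp only [TimeScale.average, TimeScale.cayleyCosh, Pi.neg_apply]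
    ring
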